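/- Let $0<p<1$ be fixed and set $b=1/(1-p)$. For a positive integer $c$, let $G(n,p,c)$ be the randomly vertex-coloured random graph on $n$ vertices in which each of the $\binom n2$ possible edges is present independently with probability $p$, and each vertex receives one of the colours $1,\dots,c$ uniformly at random, all colours being chosen independently of each other and of the edges. A set $S$ of vertices is a tropical dominating set if every vertex either belongs to $S$ or has a neighbour in $S$, and each of the $c$ colours appears on at least one vertex of $S$. Let $$c(n)=\big\lfloor \log_b n-\log_b\big[(\log_b n)(\log n)\big]\big\rfloor+2,$$ where $\log$ denotes the natural logarithm; $c(n)$ is a positive integer for all sufficiently large $n$. Then, with $c=c(n)$, the probability that $G(n,p,c)$ contains a tropical dominating set of size exactly $c$ tends to $1$ as $n\to\infty$. -/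

import Mathlib

open MeasureTheory ProbabilityTheory Filter Topology

namespace TropicalDomination

/-- `S` is a dominating set of `G`: every vertex is in `S` or has a neighbour in `S`. -/
def IsDominating {V : Type*} (G : SimpleGraph V) (S : Finset V) : Prop :=
  ∀ v, v ∈ S ∨ ∃ u ∈ S, G.Adj v u

/-- `S` is a tropical dominating set of the graph `G` with vertex colouring `col`:
it is dominating, and every colour of the palette `C` appears on a vertex of `S`.
The colouring need not be proper. -/
def IsTropicalDominating {V C : Type*} (G : SimpleGraph V) (col : V → C) (S : Finset V) : Prop :=
  IsDominating G S ∧ ∀ i : C, ∃ v ∈ S, col v = i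

/-- The law of a colouring of `n` vertices in which each vertex receives, independently,
a uniformly random one of `c` colours (a probability measure when `0 < c`). -/
noncomputable def randomColouring (n c : ℕ) : Measure (Fin n → Fin c) :=
  Measure.pi fun _ => uniformOn Set.univ

/-- The law of the randomly vertex-coloured random graph `G(n, p, c)`: the pair of a binomial
random graph `G(n, p)` and an independent uniformly random vertex colouring with `c` colours. -/
noncomputable def colouredRandomGraph (n : ℕ) (p : unitInterval) (c : ℕ) :
    Measure (SimpleGraph (Fin n) × (Fin n → Fin c)) :=
  (SimpleGraph.binomialRandom (Fin n) p).prod (randomColouring n c)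

/-- `⌊log_b n - log_b ((log_b n) (log n))⌋ + 2`, where `log` is the natural logarithm.
This integer is positive for all large `n` when `1 < b`, so that truncating it at `0`
concerns finitely many `n` only. -/
noncomputable def numColours (b : ℝ) (n : ℕ) : ℕ :=
  (⌊Real.logb b n - Real.logb b (Real.logb b n * Real.log n)⌋ + 2).toNat

end TropicalDomination

/-!
Cut out of the vertex set `r = c(n)` disjoint blocks of `m = ⌊n / r⌋` vertices, and apply the second
moment method to the transversals of the blocks which dominate and whose vertex in block `i`
receives colour `i`, for every `i`. Two transversals with `k` common vertices satisfy their colour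
constraints together `r ^ k` times as often as if they were disjoint, and by AM-GM they dominate
together at most about `w ^ k` times as often, where `w = exp (n q ^ r / r)` up to lower order terms
and `q = 1 - p`. Since membership of the common part is decided block by block, the sum of
`(r w) ^ k` over all pairs of transversals is exactly `m ^ r (m - 1 + r w) ^ r`, and Cauchy–Schwarz
bounds the failure probability by roughly `r ^ 2 w / m`. At `δ` above the threshold
`log_b n - log_b ((log_b n) (log n))`, `n q ^ r` is at most `b ^ (-δ) (log_b n) (log n)`, so
`w ≤ n ^ θ` for any `θ > b ^ (-δ)` and large `n`. As `b ^ (-δ) < 1` and `r = O(log n)`, this tends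
to `0`.
-/

namespace TropicalDomination

section SecondMoment

variable {Ω ι : Type*} [MeasurableSpace Ω] [Fintype ι] {μ : Measure Ω} {A : ι → Set Ω}

lemma sq_sum_measure_le_measure_iUnion_mul_sum_sum (hA : ∀ i, MeasurableSet (A i)) :
    (∑ i, μ (A i)) ^ 2 ≤ μ (⋃ i, A i) * ∑ i, ∑ j, μ (A i ∩ A j) := by
  set indicatorOf : Set Ω → Ω → ENNReal := fun s => s.indicator 1
  have measurable_indicatorOf {s : Set Ω} (hs : MeasurableSet s) : Measurable (indicatorOf s) :=
    measurable_one.indicator hs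
  set count : Ω → ENNReal := fun ω => ∑ i, indicatorOf (A i) ω
  have hcount : Measurable count :=
    Finset.measurable_sum _ fun i _ => measurable_indicatorOf (hA i)
  have hunion : MeasurableSet (⋃ i, A i) := .iUnion hA
  have first_moment : ∫⁻ ω, (indicatorOf (⋃ i, A i) * count) ω ∂μ = ∑ i, μ (A i) := by
    have support (ω : Ω) : (indicatorOf (⋃ i, A i) * count) ω = count ω := by
      by_cases h : ω ∈ ⋃ i, A i
      · simp [indicatorOf, h]
      · have hω : ∀ i, ω ∉ A i := by simpa using h
        simp [indicatorOf, count, hω]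
    simp_rw [support, count]
    rw [lintegral_finsetSum _ fun i _ => measurable_indicatorOf (hA i)]
    exact Finset.sum_congr rfl fun i _ => lintegral_indicator_one (hA i)
  have second_moment : ∫⁻ ω, count ω ^ (2 : ℝ) ∂μ = ∑ i, ∑ j, μ (A i ∩ A j) := by
    have expand (ω : Ω) : count ω ^ (2 : ℝ) = ∑ i, ∑ j, indicatorOf (A i ∩ A j) ω := by
      simp [count, indicatorOf, sq, Finset.sum_mul_sum, Set.inter_indicator_one]
    have hij (i j : ι) : Measurable (indicatorOf (A i ∩ A j)) :=
      measurable_indicatorOf ((hA i).inter (hA j))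
    simp_rw [expand]
    rw [lintegral_finsetSum _ fun i _ => Finset.measurable_sum _ fun j _ => hij i j]
    refine Finset.sum_congr rfl fun i _ => ?_
    rw [lintegral_finsetSum _ fun j _ => hij i j]
    exact Finset.sum_congr rfl fun j _ => lintegral_indicator_one ((hA i).inter (hA j))
  have union_moment : ∫⁻ ω, indicatorOf (⋃ i, A i) ω ^ (2 : ℝ) ∂μ = μ (⋃ i, A i) := by
    rw [← lintegral_indicator_one hunion]
    congr with ω
    by_cases h : ω ∈ ⋃ i, A i <;> simp [indicatorOf, h]
  have cauchy_schwarz := ENNReal.lintegral_mul_le_Lp_mul_Lq μ .two_two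
    (measurable_indicatorOf hunion).aemeasurable hcount.aemeasurable
  rw [first_moment, union_moment, second_moment,
    ← ENNReal.mul_rpow_of_nonneg _ _ (by norm_num)] at cauchy_schwarz
  calc (∑ i, μ (A i)) ^ 2
      ≤ ((μ (⋃ i, A i) * ∑ i, ∑ j, μ (A i ∩ A j)) ^ (1 / 2 : ℝ)) ^ 2 := by gcongr
    _ = μ (⋃ i, A i) * ∑ i, ∑ j, μ (A i ∩ A j) := by
      rw [← ENNReal.rpow_natCast, ← ENNReal.rpow_mul]
      norm_num

lemma card_sq_le_measureReal_iUnion_mul_sum_sum [IsFiniteMeasure μ]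
    (hA : ∀ i, MeasurableSet (A i)) {a : ℝ} (ha : 0 < a) (hμA : ∀ i, μ.real (A i) = a)
    {ρ : ι → ι → ℝ} (hρ : ∀ i j, μ.real (A i ∩ A j) ≤ a ^ 2 * ρ i j) :
    (Fintype.card ι : ℝ) ^ 2 ≤ μ.real (⋃ i, A i) * ∑ i, ∑ j, ρ i j := by
  have moments : (∑ i, μ.real (A i)) ^ 2 ≤
      μ.real (⋃ i, A i) * ∑ i, ∑ j, μ.real (A i ∩ A j) := by
    have h := ENNReal.toReal_mono
      (ENNReal.mul_ne_top (measure_ne_top μ _) (by simp [ENNReal.sum_eq_top]))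
      (sq_sum_measure_le_measure_iUnion_mul_sum_sum (μ := μ) hA)
    simpa [measureReal_def, ENNReal.toReal_sum] using h
  refine le_of_mul_le_mul_left ?_ (pow_pos ha 2)
  calc a ^ 2 * (Fintype.card ι : ℝ) ^ 2 = (∑ i, μ.real (A i)) ^ 2 := by
        simp only [hμA, Finset.sum_const, Finset.card_univ, nsmul_eq_mul]
        ring
    _ ≤ μ.real (⋃ i, A i) * ∑ i, ∑ j, μ.real (A i ∩ A j) := moments
    _ ≤ μ.real (⋃ i, A i) * ∑ i, ∑ j, a ^ 2 * ρ i j := by gcongr; exact hρ _ _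
    _ = a ^ 2 * (μ.real (⋃ i, A i) * ∑ i, ∑ j, ρ i j) := by
      simp_rw [← Finset.mul_sum]
      ring

end SecondMoment

section BinomialRandomGraph

lemma map_adj_binomialRandom {V α β : Type*} [Countable V] (p : unitInterval) {f : α → V}
    {g : β → V} (hf : f.Injective) (hg : g.Injective) (hfg : ∀ a b, f a ≠ g b) :
    (SimpleGraph.binomialRandom V p).map (fun G a b => G.Adj (f a) (g b)) =
      Measure.infinitePi fun _ : α => Measure.infinitePi fun _ : β => Ber(True, False, p) := by
  have edge_injective : Function.Injective fun x : α × β => s(f x.1, g x.2) := by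
    rintro ⟨a, b⟩ ⟨a', b'⟩ h
    rcases Sym2.eq_iff.1 h with ⟨ha, hb⟩ | ⟨ha, -⟩
    · exact Prod.ext (hf ha) (hg hb)
    · exact absurd ha (hfg a b')
  have adj_eq_curry : ((fun (G : SimpleGraph V) a b => G.Adj (f a) (g b)) ∘
      SimpleGraph.fromEdgeSet) ∘ (fun x : Sym2 V → Prop => {e | x e}) =
      MeasurableEquiv.curry α β Prop ∘ fun x (i : α × β) => x s(f i.1, g i.2) := by
    ext x a b
    simp [hfg a b]
  have measurable_adj : Measurable fun (G : SimpleGraph V) a b => G.Adj (f a) (g b) := by fun_prop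
  rw [SimpleGraph.binomialRandom_eq_map, setBernoulli_eq_map,
    Measure.map_map measurable_adj (by fun_prop),
    Measure.map_map (measurable_adj.comp SimpleGraph.measurable_fromEdgeSet) (by fun_prop),
    adj_eq_curry, ← Measure.map_map (by fun_prop) (by fun_prop),
    Measure.map_infinitePi_infinitePi_of_inj edge_injective,
    ← Measure.infinitePi_map_curry fun (_ : α) (_ : β) => Ber(True, False, p)]
  simp [hfg, bernoulliMeasure_def]

section BernoulliSequence

variable {β : Type*} (p : unitInterval) (S T : Finset β)

lemma measurableSet_forall_mem_not : MeasurableSet {x : β → Prop | ∀ u ∈ S, ¬ x u} :=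
  .pi (t := fun _ => {y : Prop | ¬ y}) S.countable_toSet fun _ _ => .of_discrete

lemma infinitePi_bernoulliMeasure_real_forall_mem_not :
    (Measure.infinitePi fun _ : β => Ber(True, False, p)).real {x | ∀ u ∈ S, ¬ x u} =
      (1 - p : ℝ) ^ S.card := by
  have hpi : {x : β → Prop | ∀ u ∈ S, ¬ x u} = Set.pi S fun _ => {y | ¬ y} := rfl
  rw [hpi, measureReal_def, Measure.infinitePi_pi _ fun _ _ => .of_discrete]
  simp

lemma infinitePi_bernoulliMeasure_real_exists_mem_and_exists_mem [DecidableEq β] :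
    (Measure.infinitePi fun _ : β => Ber(True, False, p)).real
        {x | (∃ u ∈ S, x u) ∧ ∃ u ∈ T, x u} =
      1 - (1 - p : ℝ) ^ S.card - (1 - p : ℝ) ^ T.card + (1 - p : ℝ) ^ (S ∪ T).card := by
  set noneIn : Finset β → Set (β → Prop) := fun S => {x | ∀ u ∈ S, ¬ x u}
  have hcompl : {x : β → Prop | (∃ u ∈ S, x u) ∧ ∃ u ∈ T, x u} = (noneIn S ∪ noneIn T)ᶜ := by
    ext x
    simp [noneIn]
  have hinter : noneIn S ∩ noneIn T = noneIn (S ∪ T) := by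
    ext x
    simp [noneIn, or_imp, forall_and]
  have inclusion_exclusion := measureReal_union_add_inter
    (μ := Measure.infinitePi fun _ : β => Ber(True, False, p)) (s := noneIn S)
    (measurableSet_forall_mem_not T)
  simp only [hinter, noneIn, infinitePi_bernoulliMeasure_real_forall_mem_not]
    at inclusion_exclusion
  rw [hcompl, measureReal_compl
    ((measurableSet_forall_mem_not S).union (measurableSet_forall_mem_not T)), probReal_univ]
  linarith

end BernoulliSequence

variable {V : Type*} [Fintype V] (p : unitInterval) (S T : Finset V)

lemma binomialRandom_real_forall_notMem_union_exists_adj [DecidableEq V] :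
    (SimpleGraph.binomialRandom V p).real
        {G | ∀ v ∉ S ∪ T, (∃ u ∈ S, G.Adj v u) ∧ ∃ u ∈ T, G.Adj v u} =
      (1 - (1 - p : ℝ) ^ S.card - (1 - p : ℝ) ^ T.card + (1 - p : ℝ) ^ (S ∪ T).card) ^
        (Fintype.card V - (S ∪ T).card) := by
  set U := S ∪ T with hU
  set meetsBoth : Set (U → Prop) := {x | (∃ u ∈ S.subtype (· ∈ U), x u) ∧
    ∃ u ∈ T.subtype (· ∈ U), x u}
  have hpre : {G : SimpleGraph V | ∀ v ∉ U, (∃ u ∈ S, G.Adj v u) ∧ ∃ u ∈ T, G.Adj v u} =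
      (fun G (v : ↥Uᶜ) (u : U) => G.Adj v u) ⁻¹'
        Set.pi (Finset.univ : Finset ↥Uᶜ) fun _ => meetsBoth := by
    ext G
    simp only [Set.mem_ofPred_eq, Set.mem_preimage, Set.mem_pi, Finset.coe_univ, Set.mem_univ,
      forall_true_left, meetsBoth, Finset.mem_subtype, Subtype.exists, Subtype.forall,
      Finset.mem_compl]
    grind
  have card_subtype {A : Finset V} (hA : A ⊆ U) : (A.subtype (· ∈ U)).card = A.card := by
    rw [Finset.card_subtype, Finset.filter_true_of_mem hA]
  have hunion : S.subtype (· ∈ U) ∪ T.subtype (· ∈ U) = U.subtype (· ∈ U) := by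
    ext x
    simpa [hU] using Finset.mem_union.1 x.2
  have law := map_adj_binomialRandom p (f := fun v : ↥Uᶜ => (v : V)) (g := fun u : U => (u : V))
    Subtype.val_injective Subtype.val_injective
    fun v u h => Finset.mem_compl.1 v.2 (h ▸ u.2)
  rw [hpre, ← map_measureReal_apply (by fun_prop) (Set.toFinite _).measurableSet, law,
    measureReal_def, Measure.infinitePi_pi _ (fun _ _ => (Set.toFinite _).measurableSet),
    ENNReal.toReal_prod]
  simp_rw [← measureReal_def, meetsBoth, infinitePi_bernoulliMeasure_real_exists_mem_and_exists_mem]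
  rw [hunion, card_subtype Finset.subset_union_left, card_subtype Finset.subset_union_right,
    card_subtype subset_rfl, Finset.prod_const, Finset.card_univ, Fintype.card_coe,
    Finset.card_compl]

lemma binomialRandom_real_isDominating :
    (SimpleGraph.binomialRandom V p).real {G | IsDominating G S} =
      (1 - (1 - p : ℝ) ^ S.card) ^ (Fintype.card V - S.card) := by
  classical
  have h := binomialRandom_real_forall_notMem_union_exists_adj p S S
  simpa only [Finset.union_self, and_self, sub_add_cancel, IsDominating, or_iff_not_imp_left]
    using h

lemma binomialRandom_real_isDominating_inter_le [DecidableEq V] :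
    (SimpleGraph.binomialRandom V p).real ({G | IsDominating G S} ∩ {G | IsDominating G T}) ≤
      (1 - (1 - p : ℝ) ^ S.card - (1 - p : ℝ) ^ T.card + (1 - p : ℝ) ^ (S ∪ T).card) ^
        (Fintype.card V - (S ∪ T).card) := by
  rw [← binomialRandom_real_forall_notMem_union_exists_adj]
  refine measureReal_mono ?_
  rintro G ⟨hS, hT⟩ v hv
  rw [Finset.mem_union, not_or] at hv
  exact ⟨(hS v).resolve_left hv.1, (hT v).resolve_left hv.2⟩

end BinomialRandomGraph

section Colouring

variable {n c : ℕ}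

instance [NeZero c] : IsProbabilityMeasure (randomColouring n c) := by
  unfold randomColouring
  infer_instance

instance [NeZero c] (p : unitInterval) : IsProbabilityMeasure (colouredRandomGraph n p c) := by
  unfold colouredRandomGraph
  infer_instance

lemma randomColouring_real_eqOn [NeZero c] (U : Finset (Fin n)) (g : Fin n → Fin c) :
    (randomColouring n c).real {col | Set.EqOn col g U} = (c : ℝ)⁻¹ ^ U.card := by
  have hpi : {col : Fin n → Fin c | Set.EqOn col g U} = Set.pi U fun v => {g v} := rfl
  rw [hpi, randomColouring, ← Measure.infinitePi_eq_pi, measureReal_def,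
    Measure.infinitePi_pi _ fun _ _ => .of_discrete]
  simp [uniformOn_univ]

/-- The event that `S` is dominating and that every vertex of `S` receives the colour which `g`
prescribes for it. -/
def dominatesWithColouring (g : Fin n → Fin c) (S : Finset (Fin n)) :
    Set (SimpleGraph (Fin n) × (Fin n → Fin c)) :=
  {G | IsDominating G S} ×ˢ {col | Set.EqOn col g S}

variable (p : unitInterval) (g : Fin n → Fin c) (S T : Finset (Fin n))

lemma measurableSet_dominatesWithColouring : MeasurableSet (dominatesWithColouring g S) := by
  refine .prod ?_ (Set.toFinite _).measurableSet
  simp only [IsDominating]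
  measurability

variable [NeZero c]

lemma colouredRandomGraph_real_dominatesWithColouring :
    (colouredRandomGraph n p c).real (dominatesWithColouring g S) =
      (1 - (1 - p : ℝ) ^ S.card) ^ (n - S.card) * (c : ℝ)⁻¹ ^ S.card := by
  rw [dominatesWithColouring, colouredRandomGraph, measureReal_prod_prod,
    binomialRandom_real_isDominating, randomColouring_real_eqOn, Fintype.card_fin]

lemma colouredRandomGraph_real_dominatesWithColouring_inter_le :
    (colouredRandomGraph n p c).real (dominatesWithColouring g S ∩ dominatesWithColouring g T) ≤
      (1 - (1 - p : ℝ) ^ S.card - (1 - p : ℝ) ^ T.card + (1 - p : ℝ) ^ (S ∪ T).card) ^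
        (n - (S ∪ T).card) * (c : ℝ)⁻¹ ^ (S ∪ T).card := by
  have hcol : {col : Fin n → Fin c | Set.EqOn col g S} ∩ {col | Set.EqOn col g T} =
      {col | Set.EqOn col g (S ∪ T : Finset (Fin n))} := by
    ext col
    simp [Set.eqOn_union]
  have hdom := binomialRandom_real_isDominating_inter_le p S T
  rw [Fintype.card_fin] at hdom
  rw [dominatesWithColouring, dominatesWithColouring, Set.prod_inter_prod, hcol,
    colouredRandomGraph, measureReal_prod_prod, randomColouring_real_eqOn]
  gcongr

end Colouring

section Overlap

/-- An upper bound for the factor by which each common vertex of two `r`-sets of vertices of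
`G(n, 1 - q)` raises the probability that both sets are dominating, apart from a factor
`((1 - q ^ r) ^ (2 * r))⁻¹` which does not depend on the number of common vertices. -/
noncomputable def overlapFactor (q : ℝ) (n r : ℕ) : ℝ :=
  Real.exp (n * q ^ r / ((1 - q ^ r) ^ 2 * r))

variable {q : ℝ} {n r k : ℕ}

lemma pow_sub_le_pow_add_div (hq0 : 0 ≤ q) (hr : r ≠ 0) (hk : k ≤ r) :
    q ^ (r - k) ≤ q ^ r + k / r := by
  have hr' : (0 : ℝ) < r := by positivity
  have weights : ((r - k : ℕ) : ℝ) / r + k / r = 1 := by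
    rw [← add_div, ← Nat.cast_add, Nat.sub_add_cancel hk, div_self hr'.ne']
  have geom_eq : (q ^ r) ^ (((r - k : ℕ) : ℝ) / r) = q ^ (r - k) := by
    rw [← Real.rpow_natCast q r, ← Real.rpow_mul hq0, mul_div_cancel₀ _ hr'.ne',
      Real.rpow_natCast]
  have weight_le_one : ((r - k : ℕ) : ℝ) / r ≤ 1 := by
    rw [div_le_one hr']
    exact_mod_cast Nat.sub_le r k
  calc q ^ (r - k) = (q ^ r) ^ (((r - k : ℕ) : ℝ) / r) * 1 ^ ((k : ℝ) / r) := by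
        rw [geom_eq, Real.one_rpow, mul_one]
    _ ≤ ((r - k : ℕ) : ℝ) / r * q ^ r + k / r * 1 :=
        Real.geom_mean_le_arith_mean2_weighted (by positivity) (by positivity) (by positivity)
          zero_le_one weights
    _ ≤ q ^ r + k / r := by
        rw [mul_one]
        gcongr
        exact mul_le_of_le_one_left (by positivity) weight_le_one

/- `1 - q ^ r - q ^ r + q ^ (2 * r - k)` is the probability that a given vertex outside two `r`-sets
with `k` common vertices has a neighbour in both. -/
lemma one_sub_sub_add_pow_nonneg (hq0 : 0 ≤ q) (hq1 : q ≤ 1) :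
    0 ≤ 1 - q ^ r - q ^ r + q ^ (2 * r - k) := by
  have hpow : (q ^ r) ^ 2 ≤ q ^ (2 * r - k) := by
    rw [← pow_mul, mul_comm r 2]
    exact pow_le_pow_of_le_one hq0 hq1 (Nat.sub_le _ _)
  linarith [sq_nonneg (1 - q ^ r)]

lemma one_sub_sub_add_pow_le (hq0 : 0 ≤ q) (hq1 : q < 1) (hr : r ≠ 0) (hk : k ≤ r) :
    1 - q ^ r - q ^ r + q ^ (2 * r - k) ≤
      (1 - q ^ r) ^ 2 * Real.exp (q ^ r / ((1 - q ^ r) ^ 2 * r) * k) := by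
  have hx : 0 < 1 - q ^ r := sub_pos.2 (pow_lt_one₀ hq0 hq1 hr)
  have hpow : q ^ (2 * r - k) ≤ (q ^ r) ^ 2 + q ^ r * (k / r) := by
    rw [show 2 * r - k = r + (r - k) by omega, pow_add, sq, ← mul_add]
    gcongr
    exact pow_sub_le_pow_add_div hq0 hr hk
  calc 1 - q ^ r - q ^ r + q ^ (2 * r - k)
      ≤ (1 - q ^ r) ^ 2 + q ^ r * (k / r) := by linarith
    _ = (1 - q ^ r) ^ 2 * (q ^ r / ((1 - q ^ r) ^ 2 * r) * k + 1) := by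
        field_simp
        ring
    _ ≤ _ := by gcongr; exact Real.add_one_le_exp _

lemma one_sub_sub_add_pow_pow_le (hq0 : 0 ≤ q) (hq1 : q < 1) (hr : r ≠ 0) (hk : k ≤ r)
    (hn : 2 * r - k ≤ n) :
    (1 - q ^ r - q ^ r + q ^ (2 * r - k)) ^ (n - (2 * r - k)) ≤
      ((1 - q ^ r) ^ (n - r)) ^ 2 * (((1 - q ^ r) ^ (2 * r))⁻¹ * overlapFactor q n r ^ k) := by
  have hx : 0 < 1 - q ^ r := sub_pos.2 (pow_lt_one₀ hq0 hq1 hr)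
  have hx1 : 1 - q ^ r ≤ 1 := sub_le_self _ (by positivity)
  set N := n - (2 * r - k)
  set δ := q ^ r / ((1 - q ^ r) ^ 2 * r)
  have hN : (1 - q ^ r) ^ (2 * N) ≤ ((1 - q ^ r) ^ (n - r)) ^ 2 * ((1 - q ^ r) ^ (2 * r))⁻¹ := by
    rw [← div_eq_mul_inv, le_div_iff₀ (by positivity), ← pow_add, ← pow_mul]
    exact pow_le_pow_of_le_one hx.le hx1 (by omega)
  have hoverlap : overlapFactor q n r ^ k = Real.exp (n * (δ * k)) := by
    rw [overlapFactor, ← Real.exp_nat_mul]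
    congr 1
    simp only [δ]
    ring
  calc (1 - q ^ r - q ^ r + q ^ (2 * r - k)) ^ N
      ≤ ((1 - q ^ r) ^ 2 * Real.exp (δ * k)) ^ N :=
        pow_le_pow_left₀ (one_sub_sub_add_pow_nonneg hq0 hq1.le)
          (one_sub_sub_add_pow_le hq0 hq1 hr hk) N
    _ = (1 - q ^ r) ^ (2 * N) * Real.exp (N * (δ * k)) := by
        rw [mul_pow, ← pow_mul, Real.exp_nat_mul]
    _ ≤ ((1 - q ^ r) ^ (n - r)) ^ 2 * ((1 - q ^ r) ^ (2 * r))⁻¹ * Real.exp (n * (δ * k)) := by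
        gcongr
        exact Nat.sub_le _ _
    _ = _ := by rw [hoverlap, mul_assoc]

lemma colouredRandomGraph_real_dominatesWithColouring_inter_le_mul {c : ℕ} [NeZero c]
    {p : unitInterval} (hp : 0 < p) (g : Fin n → Fin c) {S T : Finset (Fin n)} (hr : r ≠ 0)
    (hS : S.card = r) (hT : T.card = r) :
    (colouredRandomGraph n p c).real (dominatesWithColouring g S ∩ dominatesWithColouring g T) ≤
      ((1 - (1 - p : ℝ) ^ r) ^ (n - r) * (c : ℝ)⁻¹ ^ r) ^ 2 *
        (((1 - (1 - p : ℝ) ^ r) ^ (2 * r))⁻¹ *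
          (c * overlapFactor (1 - p) n r) ^ (S ∩ T).card) := by
  set k := (S ∩ T).card
  have hk : k ≤ r := hS ▸ Finset.card_le_card Finset.inter_subset_left
  have hcard : (S ∪ T).card = 2 * r - k := by
    rw [Finset.card_union, hS, hT, two_mul]
  have hn : 2 * r - k ≤ n := by simpa [hcard] using Finset.card_le_univ (S ∪ T)
  have hcol : (c : ℝ)⁻¹ ^ (2 * r - k) = ((c : ℝ)⁻¹ ^ r) ^ 2 * c ^ k := by
    rw [← pow_mul, mul_comm r 2, pow_sub₀ _ (by simp [NeZero.ne]) (by omega), inv_pow _ k, inv_inv]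
  have hdom := colouredRandomGraph_real_dominatesWithColouring_inter_le p g S T
  rw [hcard, hS, hT, hcol] at hdom
  refine hdom.trans ?_
  have hq := one_sub_sub_add_pow_pow_le (sub_nonneg.2 p.2.2) (sub_lt_self 1 hp) hr hk hn
  calc _ ≤ _ := mul_le_mul_of_nonneg_right hq (by positivity)
    _ = _ := by ring

end Overlap

section Transversal

variable {ι κ V : Type*}

lemma injective_apply_prodMk (e : ι × κ ↪ V) (s : ι → κ) : Function.Injective fun i => e (i, s i) :=
  fun _ _ h => (Prod.mk.inj (e.injective h)).1

/-- The vertex set that `s` selects from the disjoint blocks `e (i, ·)`, one vertex from each. -/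
def transversal [Fintype ι] (e : ι × κ ↪ V) (s : ι → κ) : Finset V :=
  Finset.univ.map ⟨_, injective_apply_prodMk e s⟩

variable [Fintype ι] (e : ι × κ ↪ V) (s t : ι → κ)

lemma mem_transversal {v : V} : v ∈ transversal e s ↔ ∃ i, e (i, s i) = v := by
  simp [transversal]

lemma card_transversal : (transversal e s).card = Fintype.card ι := by
  simp [transversal]

lemma card_transversal_inter_transversal [DecidableEq V] [DecidableEq κ] :
    (transversal e s ∩ transversal e t).card = (Finset.univ.filter fun i => s i = t i).card := by
  have hinter : transversal e s ∩ transversal e t =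
      (Finset.univ.filter fun i => s i = t i).map ⟨_, injective_apply_prodMk e s⟩ := by
    ext v
    simp only [Finset.mem_inter, mem_transversal, Finset.mem_map, Finset.mem_filter,
      Finset.mem_univ, true_and, Function.Embedding.coeFn_mk]
    constructor
    · rintro ⟨⟨i, rfl⟩, j, hj⟩
      obtain ⟨rfl, hst⟩ := Prod.mk.inj (e.injective hj)
      exact ⟨j, hst.symm, rfl⟩
    · rintro ⟨i, hst, rfl⟩
      exact ⟨⟨i, rfl⟩, i, by rw [hst]⟩
  rw [hinter, Finset.card_map]

lemma sum_sum_pow_card_filter_eq {R : Type*} [CommRing R] [DecidableEq ι] [Fintype κ]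
    [DecidableEq κ] (y : R) :
    ∑ s : ι → κ, ∑ t : ι → κ, y ^ (Finset.univ.filter fun i => s i = t i).card =
      (Fintype.card κ : R) ^ Fintype.card ι * (Fintype.card κ - 1 + y) ^ Fintype.card ι := by
  have pow_eq_prod (s t : ι → κ) : y ^ (Finset.univ.filter fun i => s i = t i).card =
      ∏ i, if s i = t i then y else 1 := by
    simp [Finset.prod_ite]
  have sum_ite (j : κ) : ∑ j', (if j = j' then y else 1) = (Fintype.card κ : R) - 1 + y := by
    have split (j' : κ) : (if j = j' then y else 1) = (if j = j' then y - 1 else 0) + 1 := by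
      split_ifs <;> ring
    simp_rw [split, Finset.sum_add_distrib, Finset.sum_ite_eq]
    simp only [mul_one, Finset.mem_univ, if_true, Finset.sum_const, Finset.card_univ, nsmul_eq_mul]
    ring
  have sum_inner (s : ι → κ) : ∑ t : ι → κ, ∏ i, (if s i = t i then y else 1) =
      (Fintype.card κ - 1 + y) ^ Fintype.card ι := by
    rw [← Fintype.prod_sum fun i j' => if s i = j' then y else 1]
    simp [sum_ite]
  simp [pow_eq_prod, sum_inner]

end Transversal

section LowerBound

variable {n r m : ℕ}

lemma exp_neg_mul_div_le_div_pow {m y : ℝ} (hm : 1 ≤ m) (hy : 0 < y) (r : ℕ) :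
    Real.exp (-(r * y / m)) ≤ (m / (m - 1 + y)) ^ r := by
  have hexp : Real.exp (-(r * y / m)) = Real.exp (-(y / m)) ^ r := by
    rw [← Real.exp_nat_mul]
    ring_nf
  rw [hexp]
  gcongr
  rw [Real.exp_neg, inv_le_comm₀ (Real.exp_pos _) (by apply div_pos <;> linarith), inv_div]
  calc (m - 1 + y) / m ≤ y / m + 1 := by
        rw [div_add_one (by positivity)]
        exact div_le_div_of_nonneg_right (by linarith) (by linarith)
    _ ≤ Real.exp (y / m) := Real.add_one_le_exp _

lemma iUnion_dominatesWithColouring_transversal_subset (e : Fin r × Fin m ↪ Fin n)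
    {g : Fin n → Fin r} (hg : ∀ x, g (e x) = x.1) :
    ⋃ s, dominatesWithColouring g (transversal e s) ⊆
      {ω | ∃ S : Finset (Fin n), S.card = r ∧ IsTropicalDominating ω.1 ω.2 S} := by
  rintro ω hω
  obtain ⟨s, hdom, hcol⟩ := Set.mem_iUnion.1 hω
  refine ⟨transversal e s, by simp [card_transversal], hdom, fun i => ?_⟩
  have hi : e (i, s i) ∈ transversal e s := (mem_transversal e s).2 ⟨i, rfl⟩
  exact ⟨_, hi, (hcol hi).trans (hg _)⟩

lemma pow_le_colouredRandomGraph_real_iUnion_mul {p : unitInterval} (hp : 0 < p) [NeZero r]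
    (e : Fin r × Fin m ↪ Fin n) (g : Fin n → Fin r) :
    ((m : ℝ) ^ r) ^ 2 ≤
      (colouredRandomGraph n p r).real (⋃ s, dominatesWithColouring g (transversal e s)) *
        (((1 - (1 - p : ℝ) ^ r) ^ (2 * r))⁻¹ *
          (m ^ r * (m - 1 + r * overlapFactor (1 - p) n r) ^ r)) := by
  have hr : r ≠ 0 := NeZero.ne r
  have hq1 : (1 - p : ℝ) ^ r < 1 :=
    pow_lt_one₀ (sub_nonneg.2 p.2.2) (sub_lt_self 1 hp) hr
  have prob_pos : 0 < (1 - (1 - p : ℝ) ^ r) ^ (n - r) * (r : ℝ)⁻¹ ^ r :=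
    mul_pos (pow_pos (sub_pos.2 hq1) _) (by positivity)
  have hcard (s : Fin r → Fin m) : (transversal e s).card = r := by
    rw [card_transversal, Fintype.card_fin]
  have second_moment := card_sq_le_measureReal_iUnion_mul_sum_sum (μ := colouredRandomGraph n p r)
    (fun s => measurableSet_dominatesWithColouring g (transversal e s)) prob_pos
    (fun s => by rw [colouredRandomGraph_real_dominatesWithColouring, hcard])
    (fun s t => colouredRandomGraph_real_dominatesWithColouring_inter_le_mul hp g hr
      (hcard s) (hcard t))
  simp_rw [card_transversal_inter_transversal, ← Finset.mul_sum, sum_sum_pow_card_filter_eq]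
    at second_moment
  simpa using second_moment

theorem le_colouredRandomGraph_real_exists_isTropicalDominating {p : unitInterval} (hp : 0 < p)
    (hr : 0 < r) (hm : 0 < m) (hmn : r * m ≤ n) :
    (1 - 2 * (r * (1 - p : ℝ) ^ r)) *
        Real.exp (-(r ^ 2 * overlapFactor (1 - p) n r / m)) ≤
      (colouredRandomGraph n p r).real
        {ω | ∃ S : Finset (Fin n), S.card = r ∧ IsTropicalDominating ω.1 ω.2 S} := by
  have : NeZero r := ⟨hr.ne'⟩
  obtain ⟨e⟩ : Nonempty (Fin r × Fin m ↪ Fin n) :=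
    Function.Embedding.nonempty_of_card_le (by simpa using hmn)
  obtain ⟨g, hg⟩ : ∃ g : Fin n → Fin r, ∀ x, g (e x) = x.1 :=
    ⟨Function.extend e Prod.fst 0, fun x => e.injective.extend_apply _ _ x⟩
  set x := (1 - p : ℝ) ^ r
  set w := overlapFactor (1 - p) n r
  have hx : 0 < 1 - x :=
    sub_pos.2 (pow_lt_one₀ (sub_nonneg.2 p.2.2) (sub_lt_self 1 hp) hr.ne')
  have hm1 : (1 : ℝ) ≤ m := by exact_mod_cast hm
  have hrw : 0 < r * w := mul_pos (by positivity) (Real.exp_pos _)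
  have hden : 0 < (m : ℝ) - 1 + r * w := by linarith
  have bernoulli : 1 - 2 * (r * x) ≤ (1 - x) ^ (2 * r) := by
    have h := one_add_mul_le_pow (a := -x) (by linarith) (2 * r)
    rw [← sub_eq_add_neg] at h
    push_cast at h
    linarith
  calc (1 - 2 * (r * x)) * Real.exp (-(r ^ 2 * w / m))
      = (1 - 2 * (r * x)) * Real.exp (-(r * (r * w) / m)) := by ring_nf
    _ ≤ (1 - x) ^ (2 * r) * (m / (m - 1 + r * w)) ^ r := by
        gcongr
        exact exp_neg_mul_div_le_div_pow hm1 hrw r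
    _ = ((m : ℝ) ^ r) ^ 2 / (((1 - x) ^ (2 * r))⁻¹ * (m ^ r * (m - 1 + r * w) ^ r)) := by
        rw [div_pow]
        field_simp
    _ ≤ (colouredRandomGraph n p r).real
          (⋃ s, dominatesWithColouring g (transversal e s)) :=
        div_le_of_le_mul₀ (by positivity) measureReal_nonneg
          (pow_le_colouredRandomGraph_real_iUnion_mul hp e g)
    _ ≤ _ := measureReal_mono (iUnion_dominatesWithColouring_transversal_subset e hg)

end LowerBound

section Threshold

open Asymptotics

/-- The real number `log_b x - log_b ((log_b x) (log x))`. It is the size `r` at which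
`x * b⁻¹ ^ r`, about the expected number of vertices of `G(x, 1 - b⁻¹)` without a neighbour in a
given `r`-set, equals `(log_b x) (log x)`. -/
noncomputable def domThreshold (b x : ℝ) : ℝ :=
  Real.logb b x - Real.logb b (Real.logb b x * Real.log x)

variable {b δ : ℝ}

lemma isLittleO_logb_logb_mul_log (hb : 1 < b) :
    (fun x => Real.logb b (Real.logb b x * Real.log x)) =o[atTop] Real.logb b := by
  have isLittleO_logb : Real.logb b =o[atTop] id := Real.isLittleO_logb_id_atTop
  have logb_logb := isLittleO_logb.comp_tendsto (Real.tendsto_logb_atTop hb)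
  have log_isBigO_logb : Real.log =O[atTop] Real.logb b :=
    (isBigO_const_mul_self (Real.log b) (Real.logb b) atTop).congr_left
      fun _ => mul_div_cancel₀ _ (Real.log_pos hb).ne'
  have logb_log :=
    (isLittleO_logb.comp_tendsto Real.tendsto_log_atTop).trans_isBigO log_isBigO_logb
  refine (logb_logb.add logb_log).congr' ?_ .rfl
  filter_upwards [eventually_gt_atTop 1] with x hx
  exact (Real.logb_mul (Real.logb_pos hb hx).ne' (Real.log_pos hx).ne').symm

lemma domThreshold_isEquivalent_logb (hb : 1 < b) :
    domThreshold b ~[atTop] Real.logb b :=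
  IsEquivalent.refl.sub_isLittleO (isLittleO_logb_logb_mul_log hb)

lemma tendsto_domThreshold_div_logb_nhds_one (hb : 1 < b) :
    Tendsto (fun x => domThreshold b x / Real.logb b x) atTop (𝓝 1) := by
  refine (isEquivalent_iff_tendsto_one ?_).1 (domThreshold_isEquivalent_logb hb)
  filter_upwards [eventually_gt_atTop 1] with x hx using (Real.logb_pos hb hx).ne'

lemma tendsto_domThreshold_atTop (hb : 1 < b) : Tendsto (domThreshold b) atTop atTop :=
  (domThreshold_isEquivalent_logb hb).symm.tendsto_atTop (Real.tendsto_logb_atTop hb)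

lemma mul_inv_pow_le_of_domThreshold_add_le {x : ℝ} (hb : 1 < b) (hx : 1 < x) {r : ℕ}
    (hr : domThreshold b x + δ ≤ r) :
    x * b⁻¹ ^ r ≤ b ^ (-δ) * (Real.logb b x * Real.log x) := by
  have hb0 : 0 < b := one_pos.trans hb
  have hx0 : 0 < x := one_pos.trans hx
  have hlog : 0 < Real.logb b x * Real.log x := mul_pos (Real.logb_pos hb hx) (Real.log_pos hx)
  calc x * b⁻¹ ^ r = b ^ (Real.logb b x) * b ^ (-(r : ℝ)) := by
        rw [Real.rpow_logb hb0 hb.ne' hx0, Real.rpow_neg hb0.le, Real.rpow_natCast, inv_pow]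
    _ = b ^ (Real.logb b x - r) := by rw [← Real.rpow_add hb0, sub_eq_add_neg]
    _ ≤ b ^ (-δ + Real.logb b (Real.logb b x * Real.log x)) := by
        gcongr
        · exact hb.le
        · rw [domThreshold] at hr
          linarith
    _ = _ := by rw [Real.rpow_add hb0, Real.rpow_logb hb0 hb.ne' hlog]

section Sequence

variable {r : ℕ → ℕ}

lemma tendsto_atTop_of_domThreshold_add_le (hb : 1 < b)
    (hr : ∀ᶠ n : ℕ in atTop, domThreshold b n + δ ≤ r n) : Tendsto r atTop atTop := by
  refine tendsto_natCast_atTop_iff.1 (tendsto_atTop_mono' _ hr ?_)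
  exact tendsto_atTop_add_const_right _ _
    ((tendsto_domThreshold_atTop hb).comp tendsto_natCast_atTop_atTop)

lemma eventually_overlapFactor_le_rpow (hb : 1 < b)
    (hr : ∀ᶠ n : ℕ in atTop, domThreshold b n + δ ≤ r n) (hδ : 0 ≤ δ) {θ : ℝ}
    (hθ : b ^ (-δ) < θ) :
    ∀ᶠ n : ℕ in atTop, overlapFactor b⁻¹ n (r n) ≤ (n : ℝ) ^ θ := by
  have hpow : Tendsto (fun n => b⁻¹ ^ r n) atTop (𝓝 0) :=
    (tendsto_pow_atTop_nhds_zero_of_lt_one (by positivity) (inv_lt_one_of_one_lt₀ hb)).comp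
      (tendsto_atTop_of_domThreshold_add_le hb hr)
  have hratio := (tendsto_domThreshold_div_logb_nhds_one hb).comp
    (tendsto_natCast_atTop_atTop (R := ℝ))
  have hlim : Tendsto (fun n : ℕ => θ * ((1 - b⁻¹ ^ r n) ^ 2 *
      (domThreshold b n / Real.logb b n))) atTop (𝓝 θ) := by
    simpa using (((hpow.const_sub 1).pow 2).mul hratio).const_mul θ
  filter_upwards [hr, hlim.eventually_const_le hθ, hpow.eventually_lt_const one_pos,
    eventually_gt_atTop 1,
    ((tendsto_domThreshold_atTop hb).comp tendsto_natCast_atTop_atTop).eventually_gt_atTop 0]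
    with n hrn hδθ hpow_lt hn hT
  have hn1 : (1 : ℝ) < n := by exact_mod_cast hn
  have hL : 0 < Real.logb b n := Real.logb_pos hb hn1
  have hlog : 0 < Real.log n := Real.log_pos hn1
  have hx : 0 < 1 - b⁻¹ ^ r n := sub_pos.2 hpow_lt
  have hTr : domThreshold b n ≤ r n := by linarith
  have hr0 : (0 : ℝ) < r n := hT.trans_le hTr
  have hθ0 : 0 < θ := (Real.rpow_pos_of_pos (one_pos.trans hb) _).trans hθ
  rw [overlapFactor, Real.rpow_def_of_pos (by linarith)]
  gcongr
  rw [div_le_iff₀ (mul_pos (pow_pos hx 2) hr0)]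
  calc n * b⁻¹ ^ r n ≤ b ^ (-δ) * (Real.logb b n * Real.log n) :=
        mul_inv_pow_le_of_domThreshold_add_le hb hn1 hrn
    _ ≤ θ * ((1 - b⁻¹ ^ r n) ^ 2 * (domThreshold b n / Real.logb b n)) *
          (Real.logb b n * Real.log n) := by gcongr
    _ = Real.log n * θ * ((1 - b⁻¹ ^ r n) ^ 2 * domThreshold b n) := by
        field_simp
    _ ≤ Real.log n * θ * ((1 - b⁻¹ ^ r n) ^ 2 * r n) := by gcongr

lemma tendsto_natCast_pow_mul_rpow_div_nhds_zero
    (hr : (fun n => (r n : ℝ)) =O[atTop] fun n : ℕ => Real.log n) (k : ℕ) {θ : ℝ} (hθ : θ < 1) :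
    Tendsto (fun n => (r n : ℝ) ^ k * (n : ℝ) ^ θ / n) atTop (𝓝 0) := by
  have log_pow : (fun n : ℕ => Real.log n ^ k) =o[atTop] fun n : ℕ => (n : ℝ) ^ (1 - θ) := by
    simpa [Function.comp_def] using
      (isLittleO_log_rpow_rpow_atTop k (sub_pos.2 hθ)).comp_tendsto tendsto_natCast_atTop_atTop
  refine ((hr.pow k).trans_isLittleO log_pow).tendsto_div_nhds_zero.congr' ?_
  filter_upwards [eventually_gt_atTop 0] with n hn
  rw [Real.rpow_sub (by positivity), Real.rpow_one]
  field_simp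

lemma eventually_le_of_isBigO_log
    (hr : (fun n => (r n : ℝ)) =O[atTop] fun n : ℕ => Real.log n) : ∀ᶠ n in atTop, r n ≤ n := by
  have h := hr.trans_isLittleO
    (Real.isLittleO_log_id_atTop.comp_tendsto tendsto_natCast_atTop_atTop)
  filter_upwards [h.eventuallyLE] with n hn
  simpa using hn

lemma tendsto_sq_mul_overlapFactor_div_nhds_zero (hb : 1 < b) (hδ : 0 < δ)
    (hlow : ∀ᶠ n : ℕ in atTop, domThreshold b n + δ ≤ r n)
    (hup : (fun n => (r n : ℝ)) =O[atTop] fun n : ℕ => Real.log n) :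
    Tendsto (fun n => (r n : ℝ) ^ 2 * overlapFactor b⁻¹ n (r n) / (n / r n : ℕ))
      atTop (𝓝 0) := by
  obtain ⟨θ, hδθ, hθ⟩ := exists_between (Real.rpow_lt_one_of_one_lt_of_neg hb (neg_neg_of_pos hδ))
  have hlim : Tendsto (fun n => 2 * ((r n : ℝ) ^ 3 * (n : ℝ) ^ θ / n)) atTop (𝓝 0) := by
    simpa using (tendsto_natCast_pow_mul_rpow_div_nhds_zero hup 3 hθ).const_mul 2
  refine squeeze_zero' (.of_forall fun n => by unfold overlapFactor; positivity) ?_ hlim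
  filter_upwards [eventually_overlapFactor_le_rpow hb hlow hδ.le hδθ,
    eventually_le_of_isBigO_log hup,
    (tendsto_atTop_of_domThreshold_add_le hb hlow).eventually_gt_atTop 0] with n hoverlap hrn hr
  have hr0 : (0 : ℝ) < r n := by exact_mod_cast hr
  have hn0 : (0 : ℝ) < n := by exact_mod_cast hr.trans_le hrn
  have hblock : (n : ℝ) / (2 * r n) ≤ (n / r n : ℕ) := by
    rw [div_le_iff₀ (mul_pos two_pos hr0)]
    have hdiv := Nat.lt_div_mul_add hr (a := n)
    have hone := Nat.div_pos hrn hr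
    exact_mod_cast (by nlinarith : n ≤ n / r n * (2 * r n))
  calc (r n : ℝ) ^ 2 * overlapFactor b⁻¹ n (r n) / (n / r n : ℕ)
      ≤ (r n : ℝ) ^ 2 * (n : ℝ) ^ θ / (n / (2 * r n)) := by gcongr
    _ = 2 * ((r n : ℝ) ^ 3 * (n : ℝ) ^ θ / n) := by field_simp

lemma tendsto_one_sub_mul_exp_neg_nhds_one (hb : 1 < b) (hδ : 0 < δ)
    (hlow : ∀ᶠ n : ℕ in atTop, domThreshold b n + δ ≤ r n)
    (hup : (fun n => (r n : ℝ)) =O[atTop] fun n : ℕ => Real.log n) :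
    Tendsto (fun n => (1 - 2 * (r n * b⁻¹ ^ r n)) *
      Real.exp (-(r n ^ 2 * overlapFactor b⁻¹ n (r n) / (n / r n : ℕ)))) atTop (𝓝 1) := by
  have hpow : Tendsto (fun n => r n * b⁻¹ ^ r n) atTop (𝓝 0) :=
    (tendsto_self_mul_const_pow_of_lt_one (by positivity) (inv_lt_one_of_one_lt₀ hb)).comp
      (tendsto_atTop_of_domThreshold_add_le hb hlow)
  simpa using ((hpow.const_mul 2).const_sub 1).mul
    (tendsto_sq_mul_overlapFactor_div_nhds_zero hb hδ hlow hup).neg.rexp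

end Sequence

lemma domThreshold_add_one_le_numColours (b : ℝ) (n : ℕ) :
    domThreshold b n + 1 ≤ numColours b n := by
  have hfloor := Int.sub_one_lt_floor (domThreshold b n)
  have htoNat : ((⌊domThreshold b n⌋ + 2 : ℤ) : ℝ) ≤ numColours b n := by
    exact_mod_cast Int.self_le_toNat _
  push_cast at htoNat
  linarith

lemma numColours_isBigO_log (hb : 1 < b) :
    (fun n => (numColours b n : ℝ)) =O[atTop] fun n : ℕ => Real.log n := by
  have threshold_add_two : (fun x => domThreshold b x + 2) =O[atTop] Real.log :=
    ((domThreshold_isEquivalent_logb hb).isBigO.trans (Real.isBigO_logb_log.mono le_top)).add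
      Real.isLittleO_const_log_atTop.isBigO
  refine IsBigO.trans (.of_norm_eventuallyLE ?_)
    (threshold_add_two.comp_tendsto tendsto_natCast_atTop_atTop)
  filter_upwards [((tendsto_domThreshold_atTop hb).comp
    tendsto_natCast_atTop_atTop).eventually_ge_atTop 0] with n hT
  have htoNat : (numColours b n : ℝ) = ((⌊domThreshold b n⌋ + 2 : ℤ) : ℝ) := by
    exact_mod_cast Int.toNat_of_nonneg (add_nonneg (Int.floor_nonneg.2 hT) zero_le_two)
  rw [Real.norm_natCast, htoNat]
  push_cast
  exact add_le_add_left (Int.floor_le _) 2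

end Threshold

end TropicalDomination

theorem mainTheorem3_general (p : ℝ) (hp0 : 0 < p) (hp1 : p < 1) (b : ℝ) (hb : b = 1 / (1 - p))
    (c : ℕ → ℕ) {δ : ℝ} (hδ : 0 < δ)
    (hlow : ∀ᶠ n : ℕ in atTop, TropicalDomination.domThreshold b n + δ ≤ c n)
    (hup : (fun n => (c n : ℝ)) =O[atTop] fun n : ℕ => Real.log n) :
    Tendsto
      (fun n : ℕ =>
        TropicalDomination.colouredRandomGraph n ⟨p, hp0.le, hp1.le⟩ (c n)
          {ω | ∃ S : Finset (Fin n),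
            S.card = c n ∧ TropicalDomination.IsTropicalDominating ω.1 ω.2 S})
      atTop (𝓝 1) := by
  have hq : 1 - p = b⁻¹ := by rw [hb, one_div, inv_inv]
  have hb1 : 1 < b := hb ▸ one_lt_one_div (sub_pos.2 hp1) (sub_lt_self 1 hp0)
  have lower_bound_tendsto := ENNReal.tendsto_ofReal
    (TropicalDomination.tendsto_one_sub_mul_exp_neg_nhds_one hb1 hδ hlow hup)
  rw [ENNReal.ofReal_one] at lower_bound_tendsto
  have c_pos : ∀ᶠ n in atTop, 0 < c n :=
    (TropicalDomination.tendsto_atTop_of_domThreshold_add_le hb1 hlow).eventually_gt_atTop 0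
  refine tendsto_of_tendsto_of_tendsto_of_le_of_le' lower_bound_tendsto tendsto_const_nhds ?_ ?_
  · filter_upwards [c_pos, TropicalDomination.eventually_le_of_isBigO_log hup] with n hc hcn
    have h := TropicalDomination.le_colouredRandomGraph_real_exists_isTropicalDominating
      (p := ⟨p, hp0.le, hp1.le⟩) hp0 hc (Nat.div_pos hcn hc) (Nat.mul_div_le n (c n))
    rw [hq] at h
    exact ENNReal.ofReal_le_of_le_toReal h
  · filter_upwards [c_pos] with n hc
    have : NeZero (c n) := ⟨hc.ne'⟩
    exact prob_le_one

theorem mainTheorem3 (p : ℝ) (hp0 : 0 < p) (hp1 : p < 1) (b : ℝ) (hb : b = 1 / (1 - p))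
    (c : ℕ → ℕ) (hc : ∀ n, c n = TropicalDomination.numColours b n) :
    Tendsto
      (fun n : ℕ =>
        TropicalDomination.colouredRandomGraph n ⟨p, hp0.le, hp1.le⟩ (c n)
          {ω | ∃ S : Finset (Fin n),
            S.card = c n ∧ TropicalDomination.IsTropicalDominating ω.1 ω.2 S})
      atTop (𝓝 1) := by
  obtain rfl : c = TropicalDomination.numColours b := funext hc
  have hb1 : 1 < b := hb ▸ one_lt_one_div (sub_pos.2 hp1) (sub_lt_self 1 hp0)
  exact mainTheorem3_general p hp0 hp1 b hb _ one_pos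
    (.of_forall (TropicalDomination.domThreshold_add_one_le_numColours b))
    (TropicalDomination.numColours_isBigO_log hb1)
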